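/- Let $X$ be a $T_1$ space. In the Choquet game $\mathsf{Ch}(X)$, on round $i<\omega$ player Empty chooses a point $x_i\in X$ and an open set $U_i\ni x_i$, with $U_i\subseteq V_{i-1}$ if $i\ge 1$, and player Nonempty answers with an open set $V_i$ such that $x_i\in V_i\subseteq U_i$. A strategy $\mathfrak S$ for Nonempty gives a legal answer $\mathfrak S(\langle x_j,U_j\rangle_{j\le i})$ to each partial play of Empty against it; it is convergent if, in every play $\langle x_i,U_i,V_i\rangle_{i<\omega}$ following $\mathfrak S$, the collection $\{V_i : i<\omega\}$ is a neighborhood basis at every point of $\bigcap_i V_i$, and stationary if $\mathfrak S(\langle x_j,U_j\rangle_{j\le i})=\mathfrak S(\langle x_i,U_i\rangle)$ for every such partial play. (No strategy is required to be winning, that is, to ensure $\bigcap_i V_i\neq\varnothing$.) A space is metacompact if every open cover has a point-finite open refinement that covers the space. Then there are a metric space $M$ and an open continuous surjection $f\colon M\to X$ with $f^{-1}(\{x\})$ compact for each $x\in X$ if and only if $X$ is metacompact and Nonempty has a convergent strategy in $\mathsf{Ch}(X)$. Moreover, if these conditions hold, then Nonempty has a stationary convergent strategy in $\mathsf{Ch}(X)$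 (which need not be a winning strategy). -/

import Mathlib

open Set Topology

universe u

/-- A space is metacompact if every open cover has a point-finite open refinement
(no separation axiom is included). -/
def Metacompact (X : Type u) [TopologicalSpace X] : Prop :=
  ∀ C : Set (Set X), (∀ U ∈ C, IsOpen U) → ⋃₀ C = univ →
    ∃ R : Set (Set X), (∀ V ∈ R, IsOpen V) ∧ ⋃₀ R = univ ∧
      (∀ V ∈ R, ∃ U ∈ C, V ⊆ U) ∧ ∀ x : X, {V ∈ R | x ∈ V}.Finite

/-- `X` is an open continuous compact image of `Y`: there is an open continuous surjection
`f : Y → X` all of whose point fibres are compact. -/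
def IsOpenContinuousCompactImage (X : Type u) [TopologicalSpace X]
    (Y : Type u) [TopologicalSpace Y] : Prop :=
  ∃ f : Y → X, IsOpenMap f ∧ Continuous f ∧ Function.Surjective f ∧
    ∀ x : X, IsCompact (f ⁻¹' {x})

namespace Choquet

/-- A move of player Empty in the Choquet game: a point together with an open set containing it. -/
structure Move (X : Type u) [TopologicalSpace X] where
  /-- the chosen point -/
  point : X
  /-- the chosen open set -/
  nhd : Set X
  isOpen_nhd : IsOpen nhd
  point_mem : point ∈ nhd

variable {X : Type u} [TopologicalSpace X]

/-- A rule `S` maps Empty's current move `a` and the list `l` of Empty's earlier moves, the most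
recent one first, to a set. `IsPartialPlay S l` says that the list `l` of moves of Empty (most
recent first) is a partial play against `S`: the open set of every move but the first is contained
in the answer of `S` to the preceding move. -/
def IsPartialPlay (S : Move X → List (Move X) → Set X) : List (Move X) → Prop
  | [] => True
  | [_] => True
  | b :: a :: l => b.nhd ⊆ S a l ∧ IsPartialPlay S (a :: l)

variable (X) in
/-- A strategy for Nonempty in the Choquet game on `X`: after every partial play against it that
ends with Empty's move `(x, U)`, it answers with an open set `V` such that `x ∈ V ⊆ U`.
(Its values at sequences of moves that are not partial plays against it are irrelevant.) -/
structure Strategy where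
  /-- the answer to the current move, given the earlier moves (most recent first) -/
  answer : Move X → List (Move X) → Set X
  isOpen_answer : ∀ a l, IsPartialPlay answer (a :: l) → IsOpen (answer a l)
  point_mem_answer : ∀ a l, IsPartialPlay answer (a :: l) → a.point ∈ answer a l
  answer_subset : ∀ a l, IsPartialPlay answer (a :: l) → answer a l ⊆ a.nhd

/-- The moves `m (n - 1), …, m 0`, in this order. -/
def history (m : ℕ → Move X) : ℕ → List (Move X)
  | 0 => []
  | n + 1 => m n :: history m n

namespace Strategy

/-- The set `V n` that Nonempty, following `S`, plays in round `n` when Empty's moves are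
`m 0, m 1, …`. -/
def reply (S : Strategy X) (m : ℕ → Move X) (n : ℕ) : Set X :=
  S.answer (m n) (history m n)

/-- The infinite sequence `m` of moves of Empty is legal against `S`, so that `m` and the replies
of `S` form a play following `S`. -/
def IsPlay (S : Strategy X) (m : ℕ → Move X) : Prop :=
  ∀ n, (m (n + 1)).nhd ⊆ S.reply m n

/-- `S` treats each move as the first move. -/
def IsStationary (S : Strategy X) : Prop :=
  ∀ a l, IsPartialPlay S.answer (a :: l) → S.answer a l = S.answer a []

/-- In every play following `S`, the sets played by Nonempty form a neighborhood basis of each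
point of their intersection. -/
def IsConvergent (S : Strategy X) : Prop :=
  ∀ m, S.IsPlay m → ∀ x ∈ ⋂ n, S.reply m n, (𝓝 x).HasBasis (fun _ : ℕ => True) (S.reply m)

end Strategy

end Choquet

/-! Both sides of the equivalence amount to having a point-finite development. An open map with
compact fibres carries fine locally finite covers of a metric space to one. Conversely, the
sequences picking one member per cover form a metrizable space mapping onto `X`, and a development
also yields a stationary convergent strategy. From a convergent strategy, metacompactness builds a
tree of partial plays with point-finite levels; König's lemma shows that the levels form a
development. -/

/-- A sequence of point-finite open covers whose stars at each point form a neighborhood basis. -/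
structure IsPointFiniteDevelopment {X : Type u} [TopologicalSpace X] (H : ℕ → Set (Set X)) :
    Prop where
  isOpen : ∀ n, ∀ h ∈ H n, IsOpen h
  exists_mem : ∀ n x, ∃ h ∈ H n, x ∈ h
  finite : ∀ n x, {h ∈ H n | x ∈ h}.Finite
  exists_star_subset : ∀ x U, IsOpen U → x ∈ U → ∃ n, ∀ h ∈ H n, x ∈ h → h ⊆ U

/-! ### Pushing covers forward along a map with compact fibres -/

section CompactFibers

variable {X M : Type u} [TopologicalSpace X]

/-- An open map with compact fibers turns open covers of a paracompact space into point-finite open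
covers of its image. -/
theorem exists_pointFinite_image_refinement [TopologicalSpace M] [ParacompactSpace M] {f : M → X}
    (hfo : IsOpenMap f) (hfs : Function.Surjective f) (hfc : ∀ x, IsCompact (f ⁻¹' {x}))
    {ι : Type u} (u : ι → Set M) (huo : ∀ i, IsOpen (u i)) (huc : ⋃ i, u i = univ) :
    ∃ R : Set (Set X), (∀ V ∈ R, IsOpen V) ∧ (∀ x, ∃ V ∈ R, x ∈ V) ∧
      (∀ V ∈ R, ∃ i, ∃ G ⊆ u i, V = f '' G) ∧ ∀ x, {V ∈ R | x ∈ V}.Finite := by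
  obtain ⟨v, hvo, hvc, hvf, hvu⟩ := precise_refinement u huo huc
  refine ⟨range fun i => f '' v i, ?_, ?_, ?_, ?_⟩
  · rintro _ ⟨i, rfl⟩
    exact hfo _ (hvo i)
  · intro x
    obtain ⟨m, rfl⟩ := hfs x
    obtain ⟨i, hi⟩ := mem_iUnion.1 (hvc ▸ mem_univ m : m ∈ ⋃ i, v i)
    exact ⟨_, ⟨i, rfl⟩, mem_image_of_mem f hi⟩
  · rintro _ ⟨i, rfl⟩
    exact ⟨i, v i, hvu i, rfl⟩
  · intro x
    -- A compact fibre meets only finitely many members of a locally finite family.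
    refine ((hvf.finite_nonempty_inter_compact (hfc x)).image fun i => f '' v i).subset ?_
    rintro _ ⟨⟨i, rfl⟩, m, hm, hmx⟩
    exact ⟨i, ⟨m, hm, hmx⟩, rfl⟩

theorem IsOpenContinuousCompactImage.metacompact [TopologicalSpace M] [ParacompactSpace M]
    (h : IsOpenContinuousCompactImage X M) : Metacompact X := by
  obtain ⟨f, hfo, hf, hfs, hfc⟩ := h
  intro C hCo hC
  obtain ⟨R, hRo, hRc, hRC, hRf⟩ := exists_pointFinite_image_refinement hfo hfs hfc
    (fun U : C => f ⁻¹' U) (fun U => (hCo U U.2).preimage hf) (by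
      rw [← preimage_iUnion, ← sUnion_eq_iUnion, hC, preimage_univ])
  refine ⟨R, hRo, eq_univ_of_forall fun x => ?_, fun V hV => ?_, hRf⟩
  · obtain ⟨V, hV, hx⟩ := hRc x
    exact ⟨V, hV, hx⟩
  · obtain ⟨U, G, hG, rfl⟩ := hRC V hV
    exact ⟨U, U.2, image_subset_iff.2 hG⟩

theorem IsOpenContinuousCompactImage.exists_isPointFiniteDevelopment [MetricSpace M]
    (h : IsOpenContinuousCompactImage X M) :
    ∃ H : ℕ → Set (Set X), IsPointFiniteDevelopment H := by
  obtain ⟨f, hfo, hf, hfs, hfc⟩ := h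
  have key (n : ℕ) := exists_pointFinite_image_refinement hfo hfs hfc
    -- Half of `1 / (n + 1)`, so that any two points of one ball are less than `1 / (n + 1)` apart.
    (fun m : M => Metric.ball m (1 / ((n : ℝ) + 1) / 2)) (fun m => Metric.isOpen_ball)
    (eq_univ_of_forall fun m => mem_iUnion.2 ⟨m, Metric.mem_ball_self (by positivity)⟩)
  choose H hHo hHc hHb hHf using key
  refine ⟨H, hHo, hHc, hHf, fun x U hU hx => ?_⟩
  obtain ⟨δ, hδ, hδU⟩ := (hfc x).exists_thickening_subset_open (hU.preimage hf)
    (fun m hm => by rw [mem_preimage, show f m = x from hm]; exact hx)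
  obtain ⟨n, hn⟩ := exists_nat_one_div_lt hδ
  refine ⟨n, fun V hV hxV => ?_⟩
  obtain ⟨c, G, hG, rfl⟩ := hHb n V hV
  obtain ⟨m, hm, hmx⟩ := hxV
  rintro _ ⟨p, hp, rfl⟩
  refine hδU (Metric.mem_thickening_iff.2 ⟨m, hmx, ?_⟩)
  have h₁ := Metric.mem_ball.1 (hG hp)
  have h₂ := Metric.mem_ball'.1 (hG hm)
  linarith [dist_triangle p c m]

end CompactFibers

/-! ### Consequences of a point-finite development -/

/-- The sequences that choose one member from each cover, with nonempty intersection. -/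
abbrev Thread {X : Type u} (H : ℕ → Set (Set X)) : Type u :=
  {s : ℕ → Set X // (∀ n, s n ∈ H n) ∧ ∃ x, ∀ n, x ∈ s n}

/-- The topology of pointwise convergence, for the discrete topology on the members. -/
abbrev threadTopology {X : Type u} (H : ℕ → Set (Set X)) : TopologicalSpace (Thread H) :=
  TopologicalSpace.induced Subtype.val (@Pi.topologicalSpace ℕ (fun _ => Set X) fun _ => ⊥)

theorem exists_metricSpace_thread {X : Type u} (H : ℕ → Set (Set X)) :
    ∃ d : MetricSpace (Thread H),
      d.toPseudoMetricSpace.toUniformSpace.toTopologicalSpace = threadTopology H := by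
  let _ : TopologicalSpace (Set X) := ⊥
  have : DiscreteTopology (Set X) := ⟨rfl⟩
  let _ : MetricSpace (ℕ → Set X) := TopologicalSpace.metrizableSpaceMetric _
  exact ⟨inferInstanceAs (MetricSpace
    {s : ℕ → Set X // (∀ n, s n ∈ H n) ∧ ∃ x, ∀ n, x ∈ s n}), rfl⟩

namespace IsPointFiniteDevelopment

variable {X : Type u} [TopologicalSpace X] {H : ℕ → Set (Set X)}

/-- Progress is read off Empty's open set instead of the round number: the answer shrinks into a
member of the first cover having no member that contains that set. Thus each round gains at least
one cover. -/
theorem exists_stationary_convergent_strategy (hH : IsPointFiniteDevelopment H) :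
    ∃ S : Choquet.Strategy X, S.IsStationary ∧ S.IsConvergent := by
  have key (a : Choquet.Move X) : ∃ V : Set X, IsOpen V ∧ a.point ∈ V ∧ V ⊆ a.nhd ∧
      ∀ i, (∀ j < i, ∃ h ∈ H j, a.nhd ⊆ h) → ∀ j ≤ i, ∃ h ∈ H j, V ⊆ h := by
    classical
    by_cases hex : ∃ n, ¬ ∃ h ∈ H n, a.nhd ⊆ h
    · obtain ⟨h, hh, hah⟩ := hH.exists_mem (Nat.find hex) a.point
      refine ⟨a.nhd ∩ h, a.isOpen_nhd.inter (hH.isOpen _ h hh), ⟨a.point_mem, hah⟩,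
        inter_subset_left, fun i hi j hj => ?_⟩
      have hle : i ≤ Nat.find hex := not_lt.1 fun hlt => Nat.find_spec hex (hi _ hlt)
      rcases (hj.trans hle).lt_or_eq with hlt | rfl
      · obtain ⟨k, hk, hak⟩ := not_not.1 (Nat.find_min hex hlt)
        exact ⟨k, hk, inter_subset_left.trans hak⟩
      · exact ⟨h, hh, inter_subset_right⟩
    · push Not at hex
      exact ⟨a.nhd, a.isOpen_nhd, a.point_mem, Subset.rfl, fun i _ j _ => hex j⟩
  choose V hVo hVp hVs hV using key
  refine ⟨⟨fun a _ => V a, fun a _ _ => hVo a, fun a _ _ => hVp a, fun a _ _ => hVs a⟩,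
    fun _ _ _ => rfl, fun m hm x hx => ?_⟩
  have hsub (n : ℕ) : ∀ j ≤ n, ∃ h ∈ H j, V (m n) ⊆ h := by
    induction n with
    | zero => exact hV _ 0 fun j hj => absurd hj (Nat.not_lt_zero j)
    | succ n ih =>
      refine hV _ (n + 1) fun j hj => ?_
      obtain ⟨h, hh, hVh⟩ := ih j (Nat.lt_succ_iff.1 hj)
      exact ⟨h, hh, (hm n).trans hVh⟩
  have hx' (n : ℕ) : x ∈ V (m n) := mem_iInter.1 hx n
  refine ⟨fun t => ⟨fun ht => ?_, ?_⟩⟩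
  · obtain ⟨U, hUt, hU, hxU⟩ := mem_nhds_iff.1 ht
    obtain ⟨n, hn⟩ := hH.exists_star_subset x U hU hxU
    obtain ⟨h, hh, hVh⟩ := hsub n n le_rfl
    exact ⟨n, trivial, (hVh.trans (hn h hh (hVh (hx' n)))).trans hUt⟩
  · rintro ⟨n, -, hn⟩
    exact Filter.mem_of_superset ((hVo (m n)).mem_nhds (hx' n)) hn

/-- A thread maps to the only point of its intersection. Fibres are products of finite sets, hence
compact. -/
theorem isOpenContinuousCompactImage_thread [T0Space X] (hH : IsPointFiniteDevelopment H) :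
    letI := threadTopology H
    IsOpenContinuousCompactImage X (Thread H) := by
  let _ : TopologicalSpace (Set X) := ⊥
  have : DiscreteTopology (Set X) := ⟨rfl⟩
  let _ : TopologicalSpace (Thread H) := threadTopology H
  have hind : IsInducing fun s : Thread H => s.1 := ⟨rfl⟩
  choose f hf using fun s : Thread H => s.2.2
  have huniq (s : Thread H) (x : X) (hx : ∀ n, x ∈ s.1 n) : f s = x := by
    refine Inseparable.eq (inseparable_iff_forall_isOpen.2 fun U hU => ⟨fun h => ?_, fun h => ?_⟩)
    · obtain ⟨n, hn⟩ := hH.exists_star_subset _ U hU h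
      exact hn _ (s.2.1 n) (hf s n) (hx n)
    · obtain ⟨n, hn⟩ := hH.exists_star_subset _ U hU h
      exact hn _ (s.2.1 n) (hx n) (hf s n)
  have hcoord (n : ℕ) : Continuous fun s : Thread H => s.1 n :=
    (continuous_apply n).comp hind.continuous
  refine ⟨f, ?_, ?_, ?_, ?_⟩
  · rw [isOpenMap_iff_nhds_le]
    intro s
    rw [Filter.le_map_iff]
    intro A hA
    rw [hind.nhds_eq_comap, Filter.mem_comap] at hA
    obtain ⟨B, hB, hBA⟩ := hA
    rw [nhds_pi, Filter.mem_pi] at hB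
    obtain ⟨I, hI, t, ht, htB⟩ := hB
    -- A basic neighborhood constrains only the coordinates in `I`; for `y` in this finite
    -- intersection, the others can be refilled with members containing `y`.
    have hopen : IsOpen (⋂ n ∈ I, s.1 n) := hI.isOpen_biInter fun n _ => hH.isOpen n _ (s.2.1 n)
    refine Filter.mem_of_superset (hopen.mem_nhds (mem_iInter₂.2 fun n _ => hf s n)) fun y hy => ?_
    classical
    choose c hc hyc using fun n => hH.exists_mem n y
    have hy' (n : ℕ) : y ∈ if n ∈ I then s.1 n else c n := by
      split_ifs with hn
      · exact mem_iInter₂.1 hy n hn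
      · exact hyc n
    let s' : Thread H := ⟨fun n => if n ∈ I then s.1 n else c n, fun n => by
      dsimp only
      split_ifs
      · exact s.2.1 n
      · exact hc n, y, hy'⟩
    refine ⟨s', hBA (htB fun n hn => ?_), huniq s' y hy'⟩
    show (if n ∈ I then s.1 n else c n) ∈ t n
    rw [if_pos hn]
    exact mem_of_mem_nhds (ht n)
  · rw [continuous_iff_continuousAt]
    intro s U hU
    obtain ⟨O, hOU, hO, hsO⟩ := mem_nhds_iff.1 hU
    obtain ⟨n, hn⟩ := hH.exists_star_subset _ O hO hsO
    have hmem : (fun s' : Thread H => s'.1 n) ⁻¹' {s.1 n} ∈ 𝓝 s :=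
      ((isOpen_discrete {s.1 n}).preimage (hcoord n)).mem_nhds rfl
    refine Filter.mem_map.2 (Filter.mem_of_superset hmem fun s' hs' => hOU (hn _ (s.2.1 n) (hf s n) ?_))
    rw [← show s'.1 n = s.1 n from hs']
    exact hf s' n
  · intro x
    choose c hc hxc using fun n => hH.exists_mem n x
    exact ⟨⟨c, hc, x, hxc⟩, huniq _ x hxc⟩
  · intro x
    rw [hind.isCompact_iff]
    have himage : (fun s : Thread H => s.1) '' (f ⁻¹' {x}) = univ.pi fun n => {h ∈ H n | x ∈ h} := by
      ext s
      constructor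
      · rintro ⟨s, hs, rfl⟩ n -
        refine ⟨s.2.1 n, ?_⟩
        rw [← show f s = x from hs]
        exact hf s n
      · intro hs
        exact ⟨⟨s, fun n => (hs n trivial).1, x, fun n => (hs n trivial).2⟩,
          huniq _ x fun n => (hs n trivial).2, rfl⟩
    rw [himage]
    exact isCompact_univ_pi fun n => (hH.finite n x).isCompact

theorem exists_metricSpace [T0Space X] (hH : IsPointFiniteDevelopment H) :
    ∃ (M : Type u) (_ : MetricSpace M), IsOpenContinuousCompactImage X M := by
  obtain ⟨d, hd⟩ := exists_metricSpace_thread H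
  refine ⟨Thread H, d, ?_⟩
  rw [hd]
  exact hH.isOpenContinuousCompactImage_thread

end IsPointFiniteDevelopment

/-- König's lemma for a sequence of nonempty finite types. -/
theorem exists_seq_of_finite_of_nonempty (α : ℕ → Type u) [∀ n, Finite (α n)]
    [∀ n, Nonempty (α n)] (π : ∀ n, α (n + 1) → α n) :
    ∃ s : ∀ n, α n, ∀ n, π n (s (n + 1)) = s n := by
  let F : CategoryTheory.Functor ℕᵒᵖ (Type u) := CategoryTheory.Functor.ofOpSequence fun n => TypeCat.ofHom (π n)
  have : ∀ j, Finite (F.obj j) := fun j => inferInstanceAs (Finite (α j.unop))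
  have : ∀ j, Nonempty (F.obj j) := fun j => inferInstanceAs (Nonempty (α j.unop))
  obtain ⟨s, hs⟩ := nonempty_sections_of_finite_inverse_system F
  refine ⟨fun n => s (.op n), fun n => ?_⟩
  have h := hs (CategoryTheory.homOfLE (Nat.le_add_right n 1)).op
  rw [CategoryTheory.Functor.ofOpSequence_map_homOfLE_succ] at h
  exact h

/-! ### The tree of partial plays -/

namespace Choquet

variable {X : Type u} [TopologicalSpace X]

namespace Strategy

/-- The answer of `S` to the last move of a partial play, or the whole space before the first
move. -/
def lastReply (S : Strategy X) : List (Move X) → Set X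
  | [] => univ
  | a :: l => S.answer a l

theorem isPartialPlay_cons (S : Strategy X) {a : Move X} {l : List (Move X)}
    (hl : IsPartialPlay S.answer l) (ha : a.nhd ⊆ S.lastReply l) :
    IsPartialPlay S.answer (a :: l) := by
  cases l with
  | nil => trivial
  | cons b l => exact ⟨ha, hl⟩

/-- A level of a tree of partial plays, each of which carries an open subset of the last answer:
the open subsets form a point-finite cover. -/
structure IsLevel (S : Strategy X) (L : Set (List (Move X) × Set X)) : Prop where
  isPartialPlay : ∀ p ∈ L, IsPartialPlay S.answer p.1
  isOpen : ∀ p ∈ L, IsOpen p.2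
  subset_lastReply : ∀ p ∈ L, p.2 ⊆ S.lastReply p.1
  exists_mem : ∀ x, ∃ p ∈ L, x ∈ p.2
  finite : ∀ x, {p ∈ L | x ∈ p.2}.Finite

theorem isLevel_root (S : Strategy X) : S.IsLevel {([], univ)} where
  isPartialPlay := by rintro _ rfl; trivial
  isOpen := by rintro _ rfl; exact isOpen_univ
  subset_lastReply := by rintro _ rfl; exact Subset.rfl
  exists_mem _ := ⟨_, rfl, mem_univ _⟩
  finite _ := (finite_singleton _).subset (sep_subset _ _)

/-- The answers to all moves extending the level cover `X`. Each member of a point-finite refinement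
selects a single parent and move, which keeps the new level point-finite. -/
theorem IsLevel.exists_next {S : Strategy X} (hX : Metacompact X)
    {L : Set (List (Move X) × Set X)} (hL : S.IsLevel L) :
    ∃ L', S.IsLevel L' ∧
      ∀ q ∈ L', ∃ p ∈ L, ∃ a : Move X, a.nhd = p.2 ∧ q.1 = a :: p.1 := by
  have hplay {p} (hp : p ∈ L) {a : Move X} (ha : a.nhd = p.2) :
      IsPartialPlay S.answer (a :: p.1) :=
    S.isPartialPlay_cons (hL.isPartialPlay p hp) (ha ▸ hL.subset_lastReply p hp)
  obtain ⟨R, hRo, hRc, hRs, hRf⟩ := hX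
    {V | ∃ p ∈ L, ∃ a : Move X, a.nhd = p.2 ∧ V = S.answer a p.1} (by
      rintro _ ⟨p, hp, a, ha, rfl⟩
      exact S.isOpen_answer _ _ (hplay hp ha)) (eq_univ_of_forall fun x => by
      obtain ⟨p, hp, hx⟩ := hL.exists_mem x
      exact ⟨_, ⟨p, hp, ⟨x, p.2, hL.isOpen p hp, hx⟩, rfl, rfl⟩,
        S.point_mem_answer ⟨x, p.2, hL.isOpen p hp, hx⟩ _ (hplay hp rfl)⟩)
  have hsel (V : R) : ∃ p ∈ L, ∃ a : Move X, a.nhd = p.2 ∧ V.1 ⊆ S.answer a p.1 := by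
    obtain ⟨_, ⟨p, hp, a, ha, rfl⟩, hV⟩ := hRs V V.2
    exact ⟨p, hp, a, ha, hV⟩
  choose p hp a ha hV using hsel
  refine ⟨range fun V : R => (a V :: (p V).1, V.1), ⟨?_, ?_, ?_, fun x => ?_, fun x => ?_⟩, ?_⟩
  · rintro _ ⟨V, rfl⟩
    exact hplay (hp V) (ha V)
  · rintro _ ⟨V, rfl⟩
    exact hRo V V.2
  · rintro _ ⟨V, rfl⟩
    exact hV V
  · obtain ⟨V, hVR, hx⟩ := (hRc ▸ mem_univ x : x ∈ ⋃₀ R)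
    exact ⟨_, ⟨⟨V, hVR⟩, rfl⟩, hx⟩
  · refine Finite.of_finite_image ((hRf x).subset ?_) (f := Prod.snd) ?_
    · rintro _ ⟨_, ⟨⟨V, rfl⟩, hx⟩, rfl⟩
      exact ⟨V.2, hx⟩
    · rintro _ ⟨⟨V, rfl⟩, -⟩ _ ⟨⟨W, rfl⟩, -⟩ h
      rw [Subtype.ext (show V.1 = W.1 from h)]
  · rintro _ ⟨V, rfl⟩
    exact ⟨p V, hp V, a V, ha V, rfl⟩

theorem IsConvergent.exists_isPointFiniteDevelopment {S : Strategy X} (hS : S.IsConvergent)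
    (hX : Metacompact X) : ∃ H : ℕ → Set (Set X), IsPointFiniteDevelopment H := by
  choose next hnext hparent using fun L : {L // S.IsLevel L} => L.2.exists_next hX
  let T (n : ℕ) : {L // S.IsLevel L} :=
    n.rec ⟨_, S.isLevel_root⟩ fun _ L => ⟨next L, hnext L⟩
  have hT (n : ℕ) : ∀ q ∈ (T (n + 1)).1, ∃ p ∈ (T n).1, ∃ a : Move X,
      a.nhd = p.2 ∧ q.1 = a :: p.1 := hparent (T n)
  refine ⟨fun n => Prod.snd '' (T n).1, ?_, ?_, ?_, ?_⟩
  · rintro n _ ⟨p, hp, rfl⟩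
    exact (T n).2.isOpen p hp
  · intro n x
    obtain ⟨p, hp, hx⟩ := (T n).2.exists_mem x
    exact ⟨_, ⟨p, hp, rfl⟩, hx⟩
  · intro n x
    refine (((T n).2.finite x).image Prod.snd).subset ?_
    rintro _ ⟨⟨p, hp, rfl⟩, hx⟩
    exact ⟨p, ⟨hp, hx⟩, rfl⟩
  · intro x U hU hxU
    by_contra! hcon
    -- The bad nodes at `x`: finitely many per level, and closed under parents. A branch of them is
    -- a play whose replies all contain `x` but none lies in `U`.
    let α (n : ℕ) : Type u := {p : List (Move X) × Set X // (p ∈ (T n).1 ∧ x ∈ p.2) ∧ ¬ p.2 ⊆ U}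
    have (n : ℕ) : Finite (α n) :=
      (((T n).2.finite x).subset fun p hp => hp.1 : {p : List (Move X) × Set X |
        (p ∈ (T n).1 ∧ x ∈ p.2) ∧ ¬ p.2 ⊆ U}.Finite).to_subtype
    have (n : ℕ) : Nonempty (α n) := by
      obtain ⟨_, ⟨p, hp, rfl⟩, hx, hpU⟩ := hcon n
      exact ⟨⟨p, ⟨hp, hx⟩, hpU⟩⟩
    have hπ (n : ℕ) (q : α (n + 1)) : ∃ p : α n, ∃ a : Move X,
        a.nhd = p.1.2 ∧ q.1.1 = a :: p.1.1 := by
      obtain ⟨q, ⟨hq, hxq⟩, hqU⟩ := q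
      obtain ⟨p, hp, a, ha, hqa⟩ := hT n q hq
      have hsub : q.2 ⊆ p.2 := by
        have h₁ := (T (n + 1)).2.subset_lastReply q hq
        have h₂ := (T (n + 1)).2.isPartialPlay q hq
        rw [hqa] at h₁ h₂
        exact ha ▸ h₁.trans (S.answer_subset a p.1 h₂)
      exact ⟨⟨p, ⟨hp, hsub hxq⟩, fun h => hqU (hsub.trans h)⟩, a, ha, hqa⟩
    choose π a ha hπa using hπ
    obtain ⟨s, hs⟩ := exists_seq_of_finite_of_nonempty α π
    -- Move `n` leads from node `n` to node `n + 1`, so reply `n` contains the open set of node `n +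
    -- 1`.
    let m (n : ℕ) : Move X := a n (s (n + 1))
    have hm (n : ℕ) : (m n).nhd = (s n).1.2 := by rw [ha, hs]
    have hist (n : ℕ) : (s n).1.1 = history m n := by
      induction n with
      | zero => exact congrArg Prod.fst (s 0).2.1.1
      | succ n ih => rw [hπa, hs, ih]; rfl
    have hreply (n : ℕ) : (s (n + 1)).1.2 ⊆ S.reply m n := by
      have h := (T (n + 1)).2.subset_lastReply _ (s (n + 1)).2.1.1
      rw [hist] at h
      exact h
    obtain ⟨n, -, hn⟩ := (hS m (fun n => hm (n + 1) ▸ hreply n) x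
      (mem_iInter.2 fun n => hreply n (s (n + 1)).2.1.2)).mem_iff.1 (hU.mem_nhds hxU)
    exact (s (n + 1)).2.2 ((hreply n).trans hn)

end Strategy

end Choquet

theorem theoremT (X : Type u) [TopologicalSpace X] [T1Space X] :
    ((∃ (M : Type u) (_ : MetricSpace M), IsOpenContinuousCompactImage X M) ↔
      (Metacompact X ∧ ∃ S : Choquet.Strategy X, S.IsConvergent)) ∧
    ((Metacompact X ∧ ∃ S : Choquet.Strategy X, S.IsConvergent) →
      ∃ S : Choquet.Strategy X, S.IsStationary ∧ S.IsConvergent) := by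
  refine ⟨⟨?_, ?_⟩, ?_⟩
  · rintro ⟨M, _, hM⟩
    obtain ⟨H, hH⟩ := hM.exists_isPointFiniteDevelopment
    obtain ⟨S, -, hS⟩ := hH.exists_stationary_convergent_strategy
    exact ⟨hM.metacompact, S, hS⟩
  · rintro ⟨hX, S, hS⟩
    obtain ⟨H, hH⟩ := hS.exists_isPointFiniteDevelopment hX
    exact hH.exists_metricSpace
  · rintro ⟨hX, S, hS⟩
    obtain ⟨H, hH⟩ := hS.exists_isPointFiniteDevelopment hX
    exact hH.exists_stationary_convergent_strategy
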